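/- Let $d\ge 3$, $\alpha\in(0,1)$ and $\beta>0$. We consider sequences $(\mathcal G_n)$ of finite simple connected $d$-regular graphs $\mathcal G_n=(\mathcal V_n,\mathcal E_n)$ such that $N_n=|\mathcal V_n|$ is nondecreasing with $N_n\to\infty$ and, for every $n$, * every ball of radius $\lfloor\alpha\log_{d-1}N_n\rfloor$ in $\mathcal G_n$ contains at most one cycle (more precisely, the subgraph induced by the ball does); * the spectral gap of $\mathcal G_n$ (the smallest nonzero eigenvalue of $\mathrm{Id}-P$, with $P$ the transition matrix of simple random walk on $\mathcal G_n$) is at least $\beta$. Call these *admissible* sequences. For a graph $G$ and a set $U$ of its vertices, $\partial_G U$ denotes the set of vertices outside $U$ that have a neighbour in $U$. Say that $\beta'>0$ is an *isoperimetric bound* for $(\mathcal G_n)$ if $|\partial_{\mathcal G_n}A|\ge\beta'|A|$ for all $n$ and all $A\subset\mathcal V_n$ with $|A|\le N_n/2$. **The fields.** Let $\tilde{\mathcal G}_n$ be the graph on $\tilde{\mathcal V}_n=\mathcal V_n\cup\mathcal E_n$ obtained by adding a vertex in the middle of every edge of $\mathcal G_n$, let $\tilde\pi(\tilde x)$ be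 the degree of $\tilde x$ in $\tilde{\mathcal G}_n$, let $\tilde Q$ be the transition matrix of simple random walk on $\tilde{\mathcal G}_n$, and let $\Pi$ be the orthogonal projection in $\ell^2(\tilde\pi)$ onto the span of $\mathbf 1$ and $w=\mathbf 1_{\mathcal V_n}-\mathbf 1_{\mathcal E_n}$. On a probability space let $Z_0^1(\tilde x)$, $Z_k(\tilde x)$ ($k\ge1$, $\tilde x\in\tilde{\mathcal V}_n$) and $\bar Z_0^2(x)$ ($x\in\mathcal V_n$) be jointly independent centred Gaussian variables with variances $\operatorname{Var}Z_0^1(\tilde x)=\operatorname{Var}Z_k(\tilde x)=\frac{d}{2\tilde\pi(\tilde x)}$ and $\operatorname{Var}\bar Z_0^2(x)=\frac12$. For $t_n\in(0,1)$ and $x\in\mathcal V_n$ set $$\Psi^1_{\mathcal G_n}(x)=\sqrt{1-t_n^2}\,\big((\mathrm{Id}-\Pi)Z_0^1\big)(x)+\sum_{k\ge1}\big((\mathrm{Id}-\Pi)\tilde Q^kZ_k\big)(x).$$ For $K,L\in\mathbb R$ let $\hat{\mathcal G}_n$ be the subgraph of $\mathcal G_n$ induced by $\hat{\mathcal V}_n=\{x\in\mathcal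 V_n:\bar Z_0^2(x)\ge L,\ \Psi^1_{\mathcal G_n}(x)\ge K\}$. **Claim.** There is an isoperimetric bound $\beta'>0$ that is common to all admissible sequences (for the given $d,\alpha,\beta$). Moreover, there is $\varepsilon>0$, depending only on $d,\alpha,\beta$, such that for every $\beta'>0$ and every $\delta>0$ there are $K_0,L_0\in\mathbb R$ with the following property. For every admissible sequence $(\mathcal G_n)$ with isoperimetric bound $\beta'$, all $K<K_0$ and $L<L_0$, every sequence $(t_n)$ in $(0,1)$ and every $n$, $$P\Big(\inf_{A\subset\hat{\mathcal V}_n:\ \delta N_n\le|A|\le N_n/2}\frac{|\partial_{\hat{\mathcal G}_n}A|}{|A|}\ge\frac{\beta'}2\Big)\ge1-N_n^{-\varepsilon},$$ where the infimum over the empty set is $+\infty$. -/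

import Mathlib

open MeasureTheory ProbabilityTheory Filter

universe u v

noncomputable section

namespace ZeroAvgGFF

/-! ### Graphs -/

/-- The outer vertex boundary of `U`: vertices outside `U` with a neighbour in `U`. -/
def vertexBoundary {V : Type u} (G : SimpleGraph V) (U : Set V) : Set V :=
  {y | y ∉ U ∧ ∃ x ∈ U, G.Adj x y}

/-- The closed ball of radius `r` around `x` (used for connected graphs only). -/
def ball {V : Type u} (G : SimpleGraph V) (x : V) (r : ℕ) : Set V :=
  {y | G.dist x y ≤ r}

/-- `G` contains at most one cycle; a cycle is identified with its set of edges, so that the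
starting point and the orientation of a closed walk do not matter. -/
def AtMostOneCycle {V : Type u} (G : SimpleGraph V) : Prop :=
  ∀ (a b : V) (p : G.Walk a a) (q : G.Walk b b), p.IsCycle → q.IsCycle →
    {e | e ∈ p.edges} = {e | e ∈ q.edges}

/-- Transition matrix of the simple random walk on `G`. -/
def walkMatrix {V : Type u} [Fintype V] (G : SimpleGraph V) [DecidableRel G.Adj] :
    Matrix V V ℝ :=
  fun x y => if G.Adj x y then ((G.degree x : ℝ))⁻¹ else 0

/-- The spectral gap of `G`: the smallest nonzero eigenvalue of `1 - P`, where `P` is the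
transition matrix of the simple random walk. -/
def spectralGap {V : Type u} [Fintype V] [DecidableEq V] (G : SimpleGraph V)
    [DecidableRel G.Adj] : ℝ :=
  sInf {μ : ℝ | μ ≠ 0 ∧ Module.End.HasEigenvalue (Matrix.toLin' (1 - walkMatrix G)) μ}

/-- The standing assumptions on the sequence of graphs: the numbers of vertices increase to
infinity, and every graph is connected and `d`-regular, has at most one cycle in each ball of
radius `⌊α log_{d-1} N⌋`, where `N` is its number of vertices, and has spectral gap at least
`β`. -/
structure GraphAssumptions (d : ℕ) (α β : ℝ) (V : ℕ → Type u) [∀ n, Fintype (V n)]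
    [∀ n, DecidableEq (V n)] (G : ∀ n, SimpleGraph (V n)) [∀ n, DecidableRel (G n).Adj] :
    Prop where
  card_mono : Monotone fun n => Fintype.card (V n)
  card_tendsto : Tendsto (fun n => Fintype.card (V n)) atTop atTop
  connected : ∀ n, (G n).Connected
  regular : ∀ n, (G n).IsRegularOfDegree d
  oneCycle : ∀ n (x : V n), AtMostOneCycle
    ((G n).induce (ball (G n) x ⌊α * Real.logb ((d : ℝ) - 1) (Fintype.card (V n))⌋₊))
  gap : ∀ n, β ≤ spectralGap (G n)

/-- `β'` is a lower bound for the vertex isoperimetric constants of all the graphs `G n`. -/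
def UniformIsoperimetry (β' : ℝ) (V : ℕ → Type u) [∀ n, Fintype (V n)]
    (G : ∀ n, SimpleGraph (V n)) : Prop :=
  ∀ n (A : Set (V n)), A.Nonempty → (A.ncard : ℝ) ≤ (Fintype.card (V n) : ℝ) / 2 →
    β' ≤ ((vertexBoundary (G n) A).ncard : ℝ) / A.ncard

/-! ### The subdivided graph -/

/-- Vertices of the graph obtained from `G` by adding a vertex in the middle of every edge. -/
abbrev SubdivVertex {V : Type u} (G : SimpleGraph V) : Type u := V ⊕ G.edgeSet

/-- A vertex and an edge are adjacent in the subdivided graph if they are incident in `G`. -/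
def subdivAdj {V : Type u} (G : SimpleGraph V) : SubdivVertex G → SubdivVertex G → Prop
  | Sum.inl x, Sum.inr e => x ∈ e.1
  | Sum.inr e, Sum.inl x => x ∈ e.1
  | Sum.inl _, Sum.inl _ => False
  | Sum.inr _, Sum.inr _ => False

/-- The graph obtained from `G` by adding a vertex in the middle of every edge. -/
def subdiv {V : Type u} (G : SimpleGraph V) : SimpleGraph (SubdivVertex G) where
  Adj := subdivAdj G
  symm := ⟨fun a b h => by
    rcases a with x | e <;> rcases b with y | f <;> exact h⟩
  loopless := ⟨fun a h => by rcases a with x | e <;> exact h⟩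

instance {V : Type u} [DecidableEq V] (G : SimpleGraph V) : DecidableRel (subdiv G).Adj :=
  fun a b => match a, b with
  | Sum.inl x, Sum.inr e => inferInstanceAs (Decidable (x ∈ e.1))
  | Sum.inr e, Sum.inl x => inferInstanceAs (Decidable (x ∈ e.1))
  | Sum.inl _, Sum.inl _ => inferInstanceAs (Decidable False)
  | Sum.inr _, Sum.inr _ => inferInstanceAs (Decidable False)

variable {V : Type u} [Fintype V] [DecidableEq V] (G : SimpleGraph V) [DecidableRel G.Adj]

/-- The eigenfunction `w` of the subdivided walk for the eigenvalue `-1`: it is `1` on vertices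
and `-1` on edges of `G`. -/
def signFun : SubdivVertex G → ℝ
  | Sum.inl _ => 1
  | Sum.inr _ => -1

/-- The orthogonal projection of `ℓ²(π)` onto the span of `1` and `w = signFun G`, where `π` is
the degree in the subdivided graph. Both functions have squared norm `∑ z, π z`, and they are
orthogonal, hence `Π f = (∑ π)⁻¹ (⟨f, 1⟩ 1 + ⟨f, w⟩ w)`. -/
def projMatrix : Matrix (SubdivVertex G) (SubdivVertex G) ℝ :=
  fun x y => (1 + signFun G x * signFun G y) * ((subdiv G).degree y : ℝ) /
    ∑ z, ((subdiv G).degree z : ℝ)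

/-- The field `ξ^k = ((Id - Π) Q^k Z)` on the vertices of `G`, where `Q` is the transition
matrix of the simple random walk on the subdivided graph. -/
def xi (k : ℕ) (Z : SubdivVertex G → ℝ) (x : V) : ℝ :=
  (((1 - projMatrix G) * walkMatrix (subdiv G) ^ k).mulVec Z) (Sum.inl x)

/-! ### The Gaussian fields -/

/-- Index set of the Gaussian variables: `first z` stands for `Z_0^1(z)`, `later k z` for
`Z_{k+1}(z)`, with `z` in the subdivided graph, and `bar x` for the copy of `Z_0^2(x)` with `x` a
vertex of `G`. -/
inductive NoiseIndex {V : Type u} (G : SimpleGraph V) : Type u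
  | first (z : SubdivVertex G)
  | later (k : ℕ) (z : SubdivVertex G)
  | bar (x : V)

/-- The variance of the Gaussian variable at a site of the subdivided graph. -/
def siteVariance (d : ℕ) (z : SubdivVertex G) : NNReal :=
  ((d : NNReal) / 2) / ((subdiv G).degree z : NNReal)

/-- The variance of each Gaussian variable. -/
def noiseVariance (d : ℕ) : NoiseIndex G → NNReal
  | NoiseIndex.first z => siteVariance G d z
  | NoiseIndex.later _ z => siteVariance G d z
  | NoiseIndex.bar x => siteVariance G d (Sum.inl x)

/-- `W` is a family of independent centred Gaussian variables with the prescribed variances. -/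
structure IsNoise (d : ℕ) {Ω : Type v} [MeasurableSpace Ω] (P : Measure Ω)
    (W : NoiseIndex G → Ω → ℝ) : Prop where
  measurable : ∀ i, Measurable (W i)
  law : ∀ i, P.map (W i) = gaussianReal 0 (noiseVariance G d i)
  indep : iIndepFun W P

/-- The pruned field `Ψ¹ = √(1 - t²) ξ^{0,1} + ∑_{k ≥ 1} ξ^k`; the series converges absolutely
almost surely on a finite connected graph. -/
def psiOne (t : ℝ) {Ω : Type v} (W : NoiseIndex G → Ω → ℝ) (x : V) (ω : Ω) : ℝ :=
  Real.sqrt (1 - t ^ 2) * xi G 0 (fun z => W (NoiseIndex.first z) ω) x +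
    ∑' k : ℕ, xi G (k + 1) (fun z => W (NoiseIndex.later k z) ω) x

/-- The vertex set of the reduced graph: the copy of `Z_0^2` is at least `L` and the pruned field
is at least `K`. -/
def hatV (t K L : ℝ) {Ω : Type v} (W : NoiseIndex G → Ω → ℝ) (ω : Ω) : Set V :=
  {x | L ≤ W (NoiseIndex.bar x) ω ∧ K ≤ psiOne G t W x ω}

/-- The reduced graph: the subgraph of `G` induced by `hatV`. -/
def hatG (t K L : ℝ) {Ω : Type v} (W : NoiseIndex G → Ω → ℝ) (ω : Ω) :
    SimpleGraph (hatV G t K L W ω) :=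
  G.induce (hatV G t K L W ω)

/-- The event that in the reduced graph all vertex sets `A` with `δ N ≤ |A| ≤ N / 2` satisfy
`|∂A| / |A| ≥ b`, where `N` is the number of vertices of the full graph `G`. -/
def expansionEvent (t K L δ b : ℝ) {Ω : Type v} (W : NoiseIndex G → Ω → ℝ) : Set Ω :=
  {ω | ∀ A : Set (hatV G t K L W ω),
    δ * (Fintype.card V : ℝ) ≤ (A.ncard : ℝ) →
    (A.ncard : ℝ) ≤ (Fintype.card V : ℝ) / 2 →
    b ≤ ((vertexBoundary (hatG G t K L W ω) A).ncard : ℝ) / A.ncard}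

end ZeroAvgGFF

end

/-!
Both parts follow from the spectral gap, the second one with `ε = 1`.

Since the graphs are regular, `1 - P` is symmetric and connectedness makes its kernel the constants,
so the gap yields a Poincaré inequality (`poincare`). Applied to a centred indicator function it
gives the common isoperimetric bound `β / 2` (`mul_card_le_card_vertexBoundary`).

For the probability estimate, a set `A` of vertices of the reduced graph loses at most the number
of removed vertices from its boundary in `G`. So it is enough that the removed vertices number at
most `β' δ N / 2`, which is at most `β' |A| / 2` when `|A| ≥ δ N` (`mem_expansionEvent`). A removed
vertex is a site where the copy of `Z_0^2` or the pruned field `Ψ¹` is below a very negative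
threshold; by Markov's inequality for the counting measure there are few of them as soon as the
`ℓ²` norms of these two fields are of order `√N`.

The norm of `Ψ¹` is controlled path by path. On the vertices of `G`, two steps of the walk on the
subdivided graph are one lazy step of the walk on `G`; this preserves the mean, and the Poincaré
inequality makes it a strict contraction of the functions of mean zero. Hence the operator
`Z ↦ ξ^k` has `ℓ²` norm decaying exponentially in `k`, at a rate depending only on `β`
(`sum_sq_xi_le`). The norm of `Ψ¹` is therefore at most a constant times `√N` on the event that
for every `k` the noise satisfies `∑ Z_k² ≤ C N κ^{-2k}`, for a suitable `κ < 1`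
(`sum_sq_psiOne_le`). Chebyshev's inequality for sums of squares of independent Gaussian variables
(`measureReal_sum_sq_ge_le`) bounds the probability that this fails at level `k` by a constant
times `κ^{4k} / N`, and summing over `k` gives `1 / N` (`measureReal_noise_large_le`).
-/

namespace ZeroAvgGFF

/-! ### Poincaré inequality and isoperimetry -/

section Graph

variable {V : Type u} [Fintype V] {G : SimpleGraph V} [DecidableRel G.Adj] {d : ℕ}

theorem walkMatrix_isHermitian (hreg : G.IsRegularOfDegree d) : (walkMatrix G).IsHermitian := by
  ext x y
  simp [walkMatrix, Matrix.conjTranspose_apply, G.adj_comm, hreg.degree_eq]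

theorem one_sub_walkMatrix_eq [DecidableEq V] (hd : 0 < d) (hreg : G.IsRegularOfDegree d) :
    1 - walkMatrix G = (d : ℝ)⁻¹ • G.lapMatrix ℝ := by
  have hd' : (d : ℝ) ≠ 0 := by positivity
  ext x y
  by_cases hxy : x = y
  · subst hxy
    simp [walkMatrix, SimpleGraph.lapMatrix, SimpleGraph.degMatrix, hreg.degree_eq, hd']
  · simp [walkMatrix, SimpleGraph.lapMatrix, SimpleGraph.degMatrix, hreg.degree_eq, hxy,
      SimpleGraph.adjMatrix_apply]

theorem sum_sum_adj_left (hreg : G.IsRegularOfDegree d) (f : V → ℝ) :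
    ∑ x, ∑ y, (if G.Adj x y then f x else 0) = d * ∑ x, f x := by
  rw [Finset.mul_sum]
  refine Finset.sum_congr rfl fun x _ => ?_
  rw [← Finset.sum_filter, Finset.sum_const, nsmul_eq_mul]
  congr 2
  rw [← hreg.degree_eq x, ← SimpleGraph.card_neighborFinset_eq_degree,
    SimpleGraph.neighborFinset_eq_filter]

theorem sum_sum_adj_right (hreg : G.IsRegularOfDegree d) (f : V → ℝ) :
    ∑ x, ∑ y, (if G.Adj x y then f y else 0) = d * ∑ x, f x := by
  rw [Finset.sum_comm, ← sum_sum_adj_left hreg f]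
  simp only [G.adj_comm]

theorem spectralGap_le_eigenvalue [DecidableEq V] {μ : ℝ} (hμ : μ ≠ 0)
    (h : Module.End.HasEigenvalue (Matrix.toLin' (1 - walkMatrix G)) μ) : spectralGap G ≤ μ := by
  refine csInf_le (Set.Finite.bddBelow ?_) ⟨hμ, h⟩
  exact (Module.End.finite_hasEigenvalue _).subset fun _ h => h.2

/-- Poincaré inequality. An eigenvector of `1 - P` for the eigenvalue `0` is constant because the
graph is connected, so a function of mean zero only sees eigenvalues above the spectral gap. -/
theorem poincare [DecidableEq V] (hd : 0 < d) (hconn : G.Connected) (hreg : G.IsRegularOfDegree d)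
    {β : ℝ} (hβ : β ≤ spectralGap G) (f : V → ℝ) (hf : ∑ x, f x = 0) :
    2 * d * β * ∑ x, f x ^ 2 ≤ ∑ x, ∑ y, (if G.Adj x y then (f x - f y) ^ 2 else 0) := by
  have hd' : (0 : ℝ) < d := by exact_mod_cast hd
  set A : Matrix V V ℝ := 1 - walkMatrix G with hA
  have hAh : A.IsHermitian := Matrix.isHermitian_one.sub (walkMatrix_isHermitian hreg)
  have hAL : A = (d : ℝ)⁻¹ • G.lapMatrix ℝ := one_sub_walkMatrix_eq hd hreg
  have hAT : A.transpose = A := by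
    rw [← Matrix.conjTranspose_eq_transpose_of_trivial]; exact hAh.eq
  set b := hAh.eigenvectorBasis
  have hquad : ∑ x, ∑ y, (if G.Adj x y then (f x - f y) ^ 2 else 0)
      = 2 * d * (f ⬝ᵥ A.mulVec f) := by
    have h := SimpleGraph.lapMatrix_toLinearMap₂' (R := ℝ) G f
    rw [Matrix.toLinearMap₂'_apply'] at h
    rw [hAL, Matrix.smul_mulVec, dotProduct_smul, h, smul_eq_mul]
    field_simp
  have hcoef (g : V → ℝ) (i : V) : inner ℝ (b i) (WithLp.toLp 2 g) = ⇑(b i) ⬝ᵥ g := by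
    simp [EuclideanSpace.inner_eq_star_dotProduct, dotProduct_comm]
  have hcoef' (g : V → ℝ) (i : V) : inner ℝ (WithLp.toLp 2 g) (b i) = ⇑(b i) ⬝ᵥ g := by
    rw [real_inner_comm, hcoef]
  have hAb (i : V) : ⇑(b i) ⬝ᵥ A.mulVec f = hAh.eigenvalues i * (⇑(b i) ⬝ᵥ f) := by
    rw [Matrix.dotProduct_mulVec, ← Matrix.mulVec_transpose, hAT,
      hAh.mulVec_eigenvectorBasis i, smul_dotProduct, smul_eq_mul]
  have hsq : ∑ x, f x ^ 2 = ∑ i, (⇑(b i) ⬝ᵥ f) ^ 2 := by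
    have h := b.sum_inner_mul_inner (WithLp.toLp 2 f) (WithLp.toLp 2 f)
    simp only [hcoef, hcoef', EuclideanSpace.inner_eq_star_dotProduct] at h
    simp only [sq, h]
    simp [dotProduct]
  have hform : f ⬝ᵥ A.mulVec f = ∑ i, hAh.eigenvalues i * (⇑(b i) ⬝ᵥ f) ^ 2 := by
    have h := b.sum_inner_mul_inner (WithLp.toLp 2 f) (WithLp.toLp 2 (A.mulVec f))
    simp only [hcoef, hcoef', hAb] at h
    rw [EuclideanSpace.inner_eq_star_dotProduct] at h
    simp only [star_trivial] at h
    rw [dotProduct_comm, ← h]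
    exact Finset.sum_congr rfl fun i _ => by ring
  rw [hquad, mul_assoc, hsq, hform, Finset.mul_sum]
  refine mul_le_mul_of_nonneg_left (Finset.sum_le_sum fun i _ => ?_) (by positivity)
  by_cases h0 : hAh.eigenvalues i = 0
  · have hb : A.mulVec ⇑(b i) = 0 := by
      rw [hAh.mulVec_eigenvectorBasis i, h0, zero_smul]
    rw [hAL, Matrix.smul_mulVec, smul_eq_zero_iff_right (inv_ne_zero hd'.ne'),
      SimpleGraph.lapMatrix_mulVec_eq_zero_iff_forall_reachable] at hb
    have : ⇑(b i) ⬝ᵥ f = 0 := by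
      obtain ⟨x₀⟩ := hconn.nonempty
      simp only [dotProduct, fun x => hb x x₀ (hconn.preconnected x x₀)]
      rw [← Finset.mul_sum, hf, mul_zero]
    simp [this]
  · refine mul_le_mul_of_nonneg_right (hβ.trans (spectralGap_le_eigenvalue h0 ?_)) (sq_nonneg _)
    refine Module.End.hasEigenvalue_of_hasEigenvector (x := ⇑(b i)) ⟨?_, ?_⟩
    · rw [Module.End.mem_eigenspace_iff, Matrix.toLin'_apply]
      exact hAh.mulVec_eigenvectorBasis i
    · intro h
      apply b.toBasis.ne_zero i
      ext x
      simpa using congrFun h x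

/-- Vertex isoperimetry from the spectral gap: the Poincaré inequality for the centred indicator
function of `A`, each vertex of the boundary carrying at most `d` edges into `A`. -/
theorem mul_card_le_card_vertexBoundary [DecidableEq V] (hd : 0 < d) (hconn : G.Connected)
    (hreg : G.IsRegularOfDegree d) {β : ℝ} (hβ0 : 0 ≤ β) (hβ : β ≤ spectralGap G) (A : Set V)
    (hA : (A.ncard : ℝ) ≤ (Fintype.card V : ℝ) / 2) :
    β / 2 * A.ncard ≤ ((vertexBoundary G A).ncard : ℝ) := by
  classical
  have hd' : (0 : ℝ) < d := by exact_mod_cast hd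
  have hne := hconn.nonempty
  have hN : (0 : ℝ) < Fintype.card V := by exact_mod_cast Fintype.card_pos
  set N : ℝ := (Fintype.card V : ℝ) with hNdef
  set a : ℝ := (A.ncard : ℝ) with hadef
  have hcard (S : Set V) : (S.ncard : ℝ) = ∑ x, (if x ∈ S then (1 : ℝ) else 0) := by
    rw [Set.ncard_eq_toFinset_card', Finset.sum_boole]
    congr 2
    ext; simp
  set f : V → ℝ := fun x => (if x ∈ A then 1 else 0) - a / N
  have hsum : ∑ x, f x = 0 := by
    simp only [f, Finset.sum_sub_distrib, ← hcard, Finset.sum_const, Finset.card_univ,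
      nsmul_eq_mul]
    change a - N * (a / N) = 0
    field_simp
    ring
  have hnorm : a / 2 ≤ ∑ x, f x ^ 2 := by
    have h1 : ∀ x, f x ^ 2 = (if x ∈ A then 1 else 0) * (1 - 2 * (a / N)) + (a / N) ^ 2 := by
      intro x
      simp only [f]
      split_ifs <;> ring
    simp only [h1, Finset.sum_add_distrib, ← Finset.sum_mul, ← hcard, Finset.sum_const,
      Finset.card_univ, nsmul_eq_mul]
    change a / 2 ≤ a * (1 - 2 * (a / N)) + N * (a / N) ^ 2
    have h2 : a * (1 - 2 * (a / N)) + N * (a / N) ^ 2 = a * (1 - a / N) := by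
      field_simp; ring
    rw [h2]
    have h3 : a / N ≤ 1 / 2 := by rw [div_le_iff₀ hN]; linarith
    have : 0 ≤ a := Nat.cast_nonneg _
    nlinarith
  have hbd : ∑ x, ∑ y, (if G.Adj x y then (f x - f y) ^ 2 else 0)
      ≤ 2 * (d * ((vertexBoundary G A).ncard : ℝ)) := by
    set S := vertexBoundary G A
    have h2 : 2 * (d * (S.ncard : ℝ)) = ∑ x, ∑ y, (if G.Adj x y then if x ∈ S then 1 else 0 else 0)
        + ∑ x, ∑ y, (if G.Adj x y then if y ∈ S then 1 else 0 else 0) := by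
      rw [sum_sum_adj_left hreg, sum_sum_adj_right hreg (fun y => if y ∈ S then 1 else 0),
        ← hcard, two_mul]
    rw [h2, ← Finset.sum_add_distrib]
    refine Finset.sum_le_sum fun x _ => ?_
    rw [← Finset.sum_add_distrib]
    refine Finset.sum_le_sum fun y _ => ?_
    by_cases hxy : G.Adj x y
    · by_cases hx : x ∈ A <;> by_cases hy : y ∈ A
      · simp only [f, hx, hy, if_true]; split_ifs <;> norm_num
      · have : y ∈ S := ⟨hy, x, hx, hxy⟩
        simp only [f, hx, hy, hxy, this, if_true, if_false]; split_ifs <;> ring_nf <;> norm_num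
      · have : x ∈ S := ⟨hx, y, hy, hxy.symm⟩
        simp only [f, hx, hy, hxy, this, if_true, if_false]; split_ifs <;> ring_nf <;> norm_num
      · simp only [f, hx, hy, if_false]; split_ifs <;> norm_num
    · simp [hxy]
  have h := (poincare hd hconn hreg hβ f hsum).trans hbd
  have h2 : 2 * d * β * (a / 2) ≤ 2 * d * β * ∑ x, f x ^ 2 :=
    mul_le_mul_of_nonneg_left hnorm (by positivity)
  have h3 : (2 * d) * (β / 2 * a) ≤ (2 * d) * ((vertexBoundary G A).ncard : ℝ) := by linarith
  exact le_of_mul_le_mul_left h3 (by positivity)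

/-- One step of the lazy random walk on `G`; it is the square of the walk on the subdivided graph,
restricted to the vertices of `G`. -/
noncomputable def lazyStep (d : ℕ) (G : SimpleGraph V) [DecidableRel G.Adj] (f : V → ℝ) (x : V) :
    ℝ :=
  (d : ℝ)⁻¹ * ∑ y, (if G.Adj x y then (f x + f y) / 2 else 0)

theorem sum_lazyStep (hd : 0 < d) (hreg : G.IsRegularOfDegree d) (f : V → ℝ) :
    ∑ x, lazyStep d G f x = ∑ x, f x := by
  have hd' : (d : ℝ) ≠ 0 := by positivity
  have h : ∀ x y, (if G.Adj x y then (f x + f y) / 2 else 0)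
      = ((if G.Adj x y then f x else 0) + (if G.Adj x y then f y else 0)) / 2 := by
    intro x y; split_ifs <;> simp
  simp only [lazyStep, ← Finset.mul_sum, h, ← Finset.sum_div, Finset.sum_add_distrib,
    sum_sum_adj_left hreg, sum_sum_adj_right hreg]
  field_simp
  ring

theorem lazyStep_sub_const (hd : 0 < d) (hreg : G.IsRegularOfDegree d) (f : V → ℝ) (c : ℝ) (x : V) :
    lazyStep d G (fun y => f y - c) x = lazyStep d G f x - c := by
  have hd' : (d : ℝ) ≠ 0 := by positivity
  have h : ∀ y, (if G.Adj x y then ((f x - c) + (f y - c)) / 2 else 0)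
      = (if G.Adj x y then (f x + f y) / 2 else 0) - (if G.Adj x y then c else 0) := by
    intro y; split_ifs <;> ring
  have h2 : ∑ y, (if G.Adj x y then c else 0) = d * c := by
    rw [← Finset.sum_filter, Finset.sum_const, nsmul_eq_mul, ← hreg.degree_eq x,
      ← SimpleGraph.card_neighborFinset_eq_degree, SimpleGraph.neighborFinset_eq_filter]
  simp only [lazyStep, h, Finset.sum_sub_distrib, h2]
  field_simp

/-- An average over the `d` neighbours of a vertex is a contraction for squares. -/
theorem sq_inv_mul_sum_adj_le (hd : 0 < d) (hreg : G.IsRegularOfDegree d) (g : V → ℝ) (x : V) :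
    ((d : ℝ)⁻¹ * ∑ y, (if G.Adj x y then g y else 0)) ^ 2
      ≤ (d : ℝ)⁻¹ * ∑ y, (if G.Adj x y then g y ^ 2 else 0) := by
  have hd' : (0 : ℝ) < d := by exact_mod_cast hd
  rw [← Finset.sum_filter, ← Finset.sum_filter, ← SimpleGraph.neighborFinset_eq_filter]
  have h := sq_sum_le_card_mul_sum_sq (s := G.neighborFinset x) (f := g)
  rw [SimpleGraph.card_neighborFinset_eq_degree, hreg.degree_eq x] at h
  rw [mul_pow]
  calc _ ≤ (d : ℝ)⁻¹ ^ 2 * (d * ∑ y ∈ G.neighborFinset x, g y ^ 2) := by gcongr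
    _ = _ := by field_simp

/-- The square of an average of two values falls short of the average of their squares by a quarter
of the squared difference; after summation this deficit is the Dirichlet form, to which the
Poincaré inequality applies. -/
theorem sum_sq_lazyStep_le [DecidableEq V] (hd : 0 < d) (hconn : G.Connected)
    (hreg : G.IsRegularOfDegree d) {β : ℝ} (hβ : β ≤ spectralGap G) (f : V → ℝ)
    (hf : ∑ x, f x = 0) :
    ∑ x, lazyStep d G f x ^ 2 ≤ (1 - β / 2) * ∑ x, f x ^ 2 := by
  have hd' : (0 : ℝ) < d := by exact_mod_cast hd
  have h : ∀ x y, (if G.Adj x y then ((f x + f y) / 2) ^ 2 else 0)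
      = ((if G.Adj x y then f x ^ 2 else 0) + (if G.Adj x y then f y ^ 2 else 0)) / 2
        - (if G.Adj x y then (f x - f y) ^ 2 else 0) / 4 := by
    intro x y; split_ifs <;> ring
  calc ∑ x, lazyStep d G f x ^ 2
      ≤ ∑ x, (d : ℝ)⁻¹ * ∑ y, (if G.Adj x y then ((f x + f y) / 2) ^ 2 else 0) :=
        Finset.sum_le_sum fun x _ =>
          sq_inv_mul_sum_adj_le hd hreg (fun y => (f x + f y) / 2) x
    _ = ∑ x, f x ^ 2 - (d : ℝ)⁻¹ / 4 *
          ∑ x, ∑ y, (if G.Adj x y then (f x - f y) ^ 2 else 0) := by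
        simp only [h, ← Finset.mul_sum, Finset.sum_sub_distrib, ← Finset.sum_div,
          Finset.sum_add_distrib, sum_sum_adj_left hreg (fun x => f x ^ 2),
          sum_sum_adj_right hreg (fun x => f x ^ 2)]
        field_simp
        ring
    _ ≤ ∑ x, f x ^ 2 - (d : ℝ)⁻¹ / 4 * (2 * d * β * ∑ x, f x ^ 2) := by
        gcongr
        exact poincare hd hconn hreg hβ f hf
    _ = _ := by field_simp; ring

end Graph

/-! ### The walk on the subdivided graph -/

section Subdivision

variable {V : Type u} [Fintype V] {G : SimpleGraph V} [DecidableRel G.Adj] {d : ℕ}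

theorem cast_degree_eq_sum {W : Type*} [Fintype W] (H : SimpleGraph W) [DecidableRel H.Adj] (z : W) :
    (H.degree z : ℝ) = ∑ y, (if H.Adj z y then 1 else 0) := by
  rw [Finset.sum_boole, ← SimpleGraph.card_neighborFinset_eq_degree,
    SimpleGraph.neighborFinset_eq_filter]

theorem two_mul_card_edgeSet (hreg : G.IsRegularOfDegree d) :
    2 * (Fintype.card G.edgeSet : ℝ) = d * Fintype.card V := by
  have h := G.sum_degrees_eq_twice_card_edges
  simp only [hreg.degree_eq, Finset.sum_const, Finset.card_univ, smul_eq_mul,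
    SimpleGraph.edgeFinset_card] at h
  rw [mul_comm (d : ℝ)]
  exact_mod_cast h.symm

theorem sum_sq_sub_mean_le (f : V → ℝ) :
    ∑ x, (f x - (∑ y, f y) / Fintype.card V) ^ 2 ≤ ∑ x, f x ^ 2 := by
  rcases isEmpty_or_nonempty V with h | h
  · simp
  have hN : (0 : ℝ) < Fintype.card V := by exact_mod_cast Fintype.card_pos
  set m := (∑ y, f y) / Fintype.card V with hm
  have h1 : ∑ y, f y = Fintype.card V * m := by rw [hm]; field_simp
  have h2 : ∀ x, (f x - m) ^ 2 = f x ^ 2 - f x * (2 * m) + m ^ 2 := fun x => by ring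
  simp only [h2, Finset.sum_add_distrib, Finset.sum_sub_distrib, ← Finset.sum_mul, h1,
    Finset.sum_const, Finset.card_univ, nsmul_eq_mul]
  nlinarith [mul_nonneg hN.le (sq_nonneg m)]

variable [DecidableEq V]

/-- The edges at `x` are indexed by the neighbours of `x`. -/
theorem sum_edgeSet_ite_mem (F : Sym2 V → ℝ) (x : V) :
    ∑ e : G.edgeSet, (if x ∈ e.1 then F e.1 else 0)
      = ∑ y, (if G.Adj x y then F s(x, y) else 0) := by
  rw [← Finset.sum_filter, ← Finset.sum_filter]
  symm
  refine Finset.sum_bij (fun y hy => ⟨s(x, y), by simpa using hy⟩) ?_ ?_ ?_ ?_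
  · intro y hy; simp
  · intro y hy z hz h
    exact Sym2.congr_right.mp (congrArg Subtype.val h)
  · rintro ⟨e, he⟩ hxe
    simp only [Finset.mem_filter, Finset.mem_univ, true_and] at hxe
    obtain ⟨y, rfl⟩ := Sym2.mem_iff_exists.mp hxe
    exact ⟨y, by simpa using he, rfl⟩
  · intro y hy; rfl

theorem sum_ite_mem_edge (F : V → ℝ) {a b : V} (hab : a ≠ b) :
    ∑ y, (if y ∈ s(a, b) then F y else 0) = F a + F b := by
  rw [← Finset.sum_filter, ← Finset.sum_pair hab]
  refine Finset.sum_congr ?_ fun _ _ => rfl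
  ext y; simp

theorem subdiv_degree_inl (hreg : G.IsRegularOfDegree d) (x : V) :
    ((subdiv G).degree (Sum.inl x) : ℝ) = d := by
  rw [cast_degree_eq_sum, Fintype.sum_sum_type]
  change ∑ y : V, (if False then (1 : ℝ) else 0) + ∑ e : G.edgeSet, (if x ∈ e.1 then 1 else 0) = _
  rw [sum_edgeSet_ite_mem (fun _ => 1), ← cast_degree_eq_sum, hreg.degree_eq]
  simp

theorem subdiv_degree_inr (e : G.edgeSet) : ((subdiv G).degree (Sum.inr e) : ℝ) = 2 := by
  rw [cast_degree_eq_sum, Fintype.sum_sum_type]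
  change ∑ y : V, (if y ∈ e.1 then (1 : ℝ) else 0) + ∑ e : G.edgeSet, (if False then 1 else 0) = _
  obtain ⟨e, he⟩ := e
  induction e with | _ a b
  rw [sum_ite_mem_edge (fun _ => 1) (SimpleGraph.Adj.ne he)]
  norm_num

theorem walkMatrix_subdiv_mulVec_inl (hreg : G.IsRegularOfDegree d) (u : SubdivVertex G → ℝ)
    (x : V) : (walkMatrix (subdiv G)).mulVec u (Sum.inl x)
      = (d : ℝ)⁻¹ * ∑ e : G.edgeSet, (if x ∈ e.1 then u (Sum.inr e) else 0) := by
  simp only [Matrix.mulVec, dotProduct, walkMatrix, subdiv_degree_inl hreg]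
  rw [Fintype.sum_sum_type, Finset.mul_sum]
  change ∑ y : V, (if False then (d : ℝ)⁻¹ else 0) * u (Sum.inl y)
    + ∑ e : G.edgeSet, (if x ∈ e.1 then (d : ℝ)⁻¹ else 0) * u (Sum.inr e) = _
  simp

theorem walkMatrix_subdiv_mulVec_inr (u : SubdivVertex G → ℝ) (e : G.edgeSet) :
    (walkMatrix (subdiv G)).mulVec u (Sum.inr e)
      = 2⁻¹ * ∑ y, (if y ∈ e.1 then u (Sum.inl y) else 0) := by
  simp only [Matrix.mulVec, dotProduct, walkMatrix, subdiv_degree_inr]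
  rw [Fintype.sum_sum_type, Finset.mul_sum]
  change ∑ y : V, (if y ∈ e.1 then (2 : ℝ)⁻¹ else 0) * u (Sum.inl y)
    + ∑ f : G.edgeSet, (if False then (2 : ℝ)⁻¹ else 0) * u (Sum.inr f) = _
  simp

/-- Two steps of the walk on the subdivided graph are one lazy step on `G`. -/
theorem walkMatrix_subdiv_mulVec_mulVec_inl (hreg : G.IsRegularOfDegree d)
    (u : SubdivVertex G → ℝ) (x : V) :
    (walkMatrix (subdiv G)).mulVec ((walkMatrix (subdiv G)).mulVec u) (Sum.inl x)
      = lazyStep d G (fun y => u (Sum.inl y)) x := by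
  rw [walkMatrix_subdiv_mulVec_inl hreg]
  simp only [walkMatrix_subdiv_mulVec_inr]
  rw [sum_edgeSet_ite_mem (fun e => 2⁻¹ * ∑ y, (if y ∈ e then u (Sum.inl y) else 0)), lazyStep]
  congr 1
  refine Finset.sum_congr rfl fun y _ => ?_
  split_ifs with h
  · rw [sum_ite_mem_edge _ h.ne]; ring
  · rfl

/-- On the vertices of `G`, `Π u` is the mean of `u` over these vertices: the contributions of the
edge vertices to the components along `1` and `w` cancel. -/
theorem projMatrix_mulVec_inl (hd : 0 < d) (hreg : G.IsRegularOfDegree d)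
    (u : SubdivVertex G → ℝ) (x : V) : (projMatrix G).mulVec u (Sum.inl x)
      = (∑ y : V, u (Sum.inl y)) / Fintype.card V := by
  have hd' : (d : ℝ) ≠ 0 := by positivity
  have hN : (Fintype.card V : ℝ) ≠ 0 := by
    have : Nonempty V := ⟨x⟩
    exact_mod_cast Fintype.card_ne_zero
  have hsum : ∑ z, ((subdiv G).degree z : ℝ) = 2 * d * Fintype.card V := by
    rw [Fintype.sum_sum_type]
    simp only [subdiv_degree_inl hreg, subdiv_degree_inr, Finset.sum_const, Finset.card_univ,
      nsmul_eq_mul]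
    linarith [two_mul_card_edgeSet hreg]
  simp only [Matrix.mulVec, dotProduct, projMatrix, hsum]
  rw [Fintype.sum_sum_type]
  simp only [signFun, subdiv_degree_inl hreg, subdiv_degree_inr]
  rw [Finset.sum_div, ← add_zero (∑ i, _ / _)]
  congr 1
  · refine Finset.sum_congr rfl fun y _ => ?_
    field_simp
    ring
  · simp

theorem xi_apply (hd : 0 < d) (hreg : G.IsRegularOfDegree d) (k : ℕ) (Z : SubdivVertex G → ℝ)
    (x : V) : xi G k Z x = (walkMatrix (subdiv G) ^ k).mulVec Z (Sum.inl x)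
      - (∑ y : V, (walkMatrix (subdiv G) ^ k).mulVec Z (Sum.inl y)) / Fintype.card V := by
  rw [xi, ← Matrix.mulVec_mulVec, Matrix.sub_mulVec, Matrix.one_mulVec, Pi.sub_apply,
    projMatrix_mulVec_inl hd hreg]

theorem sum_xi (hd : 0 < d) (hreg : G.IsRegularOfDegree d) (k : ℕ) (Z : SubdivVertex G → ℝ) :
    ∑ x, xi G k Z x = 0 := by
  rcases isEmpty_or_nonempty V with h | h
  · simp
  have hN : (Fintype.card V : ℝ) ≠ 0 := by exact_mod_cast Fintype.card_ne_zero
  simp only [xi_apply hd hreg, Finset.sum_sub_distrib, Finset.sum_const, Finset.card_univ,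
    nsmul_eq_mul]
  field_simp
  ring

theorem xi_add_two (hd : 0 < d) (hreg : G.IsRegularOfDegree d) (k : ℕ) (Z : SubdivVertex G → ℝ) :
    xi G (k + 2) Z = lazyStep d G (xi G k Z) := by
  have h : ∀ x : V, (walkMatrix (subdiv G) ^ (k + 2)).mulVec Z (Sum.inl x)
      = lazyStep d G (fun y => (walkMatrix (subdiv G) ^ k).mulVec Z (Sum.inl y)) x := by
    intro x
    rw [← walkMatrix_subdiv_mulVec_mulVec_inl hreg, Matrix.mulVec_mulVec, Matrix.mulVec_mulVec,
      pow_succ' _ (k + 1), pow_succ' _ k, mul_assoc]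
  ext x
  rw [xi_apply hd hreg]
  simp only [h]
  rw [sum_lazyStep hd hreg, ← lazyStep_sub_const hd hreg]
  congr 1
  ext y
  rw [xi_apply hd hreg]

theorem sum_sq_xi_zero_le (hd : 0 < d) (hreg : G.IsRegularOfDegree d) (Z : SubdivVertex G → ℝ) :
    ∑ x, xi G 0 Z x ^ 2 ≤ ∑ z, Z z ^ 2 := by
  simp only [xi_apply hd hreg, pow_zero, Matrix.one_mulVec]
  refine (sum_sq_sub_mean_le fun x => Z (Sum.inl x)).trans ?_
  rw [Fintype.sum_sum_type]
  have : 0 ≤ ∑ e : G.edgeSet, Z (Sum.inr e) ^ 2 := Finset.sum_nonneg fun _ _ => sq_nonneg _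
  linarith

theorem sum_sq_xi_one_le (hd : 2 ≤ d) (hreg : G.IsRegularOfDegree d) (Z : SubdivVertex G → ℝ) :
    ∑ x, xi G 1 Z x ^ 2 ≤ ∑ z, Z z ^ 2 := by
  have hd0 : 0 < d := by omega
  have hd' : (2 : ℝ) ≤ d := by exact_mod_cast hd
  simp only [xi_apply hd0 hreg, pow_one]
  refine (sum_sq_sub_mean_le fun x => (walkMatrix (subdiv G)).mulVec Z (Sum.inl x)).trans ?_
  have h1 : ∀ x : V, (walkMatrix (subdiv G)).mulVec Z (Sum.inl x) ^ 2
      ≤ (d : ℝ)⁻¹ * ∑ e : G.edgeSet, (if x ∈ e.1 then Z (Sum.inr e) ^ 2 else 0) := by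
    intro x
    classical
    -- Extending `Z` by zero to all unordered pairs turns sums over edges at `x` into sums over
    -- neighbours of `x`.
    set F : Sym2 V → ℝ := fun e => if h : e ∈ G.edgeSet then Z (Sum.inr ⟨e, h⟩) else 0 with hF
    have hZ : ∀ e : G.edgeSet, Z (Sum.inr e) = F e.1 := fun e => by simp [hF]
    rw [walkMatrix_subdiv_mulVec_inl hreg]
    simp only [hZ]
    rw [sum_edgeSet_ite_mem F, sum_edgeSet_ite_mem fun e => F e ^ 2]
    exact sq_inv_mul_sum_adj_le hd0 hreg (fun y => F s(x, y)) x
  have h2 : ∀ e : G.edgeSet, ∑ x, (if x ∈ e.1 then Z (Sum.inr e) ^ 2 else 0)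
      = 2 * Z (Sum.inr e) ^ 2 := by
    rintro ⟨e, he⟩
    induction e with | _ a b
    rw [sum_ite_mem_edge _ (SimpleGraph.Adj.ne he)]
    ring
  refine (Finset.sum_le_sum fun x _ => h1 x).trans ?_
  rw [← Finset.mul_sum, Finset.sum_comm]
  simp only [h2]
  rw [← Finset.mul_sum, ← mul_assoc, Fintype.sum_sum_type]
  have h3 : (d : ℝ)⁻¹ * 2 ≤ 1 := by
    rw [inv_mul_le_iff₀ (by linarith)]; linarith
  have h4 : 0 ≤ ∑ e : G.edgeSet, Z (Sum.inr e) ^ 2 := Finset.sum_nonneg fun _ _ => sq_nonneg _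
  have h5 : 0 ≤ ∑ x : V, Z (Sum.inl x) ^ 2 := Finset.sum_nonneg fun _ _ => sq_nonneg _
  nlinarith

/-- Exponential decay in `ℓ²`: two steps of the walk on the subdivided graph are one lazy step on
`G`, and this contracts functions of mean zero by the Poincaré inequality. -/
theorem sum_sq_xi_le (hd : 2 ≤ d) (hconn : G.Connected) (hreg : G.IsRegularOfDegree d) {β ρ : ℝ}
    (hβ : β ≤ spectralGap G) (hρ0 : 0 ≤ ρ) (hρ : 1 - β / 2 ≤ ρ) (Z : SubdivVertex G → ℝ) (k : ℕ) :
    ∑ x, xi G k Z x ^ 2 ≤ ρ ^ (k / 2) * ∑ z, Z z ^ 2 := by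
  have hd0 : 0 < d := by omega
  induction k using Nat.twoStepInduction with
  | zero => simpa using sum_sq_xi_zero_le hd0 hreg Z
  | one => simpa using sum_sq_xi_one_le hd hreg Z
  | more k ih _ =>
    rw [xi_add_two hd0 hreg]
    have h : (k + 2) / 2 = k / 2 + 1 := by omega
    calc _ ≤ (1 - β / 2) * ∑ x, xi G k Z x ^ 2 :=
          sum_sq_lazyStep_le hd0 hconn hreg hβ _ (sum_xi hd0 hreg k Z)
      _ ≤ ρ * (ρ ^ (k / 2) * ∑ z, Z z ^ 2) := by
          gcongr
      _ = _ := by rw [h, pow_succ]; ring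

end Subdivision

/-! ### Sums of squares of Gaussian variables -/

section Gaussian

variable {Ω : Type v} [MeasurableSpace Ω] {P : Measure Ω} [IsProbabilityMeasure P]

/-- The fourth moment of a standard Gaussian variable. -/
noncomputable def gaussianFourthMoment : ℝ := ∫ x, x ^ 4 ∂gaussianReal 0 1

theorem gaussianFourthMoment_nonneg : 0 ≤ gaussianFourthMoment :=
  integral_nonneg fun x => by positivity

theorem integral_pow_four_gaussianReal (v : NNReal) :
    ∫ x, x ^ 4 ∂gaussianReal 0 v = (v : ℝ) ^ 2 * gaussianFourthMoment := by
  have h := gaussianReal_map_const_mul (μ := 0) (v := 1) (Real.sqrt v)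
  have hv : NNReal.mk (Real.sqrt v ^ 2) (sq_nonneg _) * 1 = v := by
    ext; simp
  rw [mul_zero, hv] at h
  rw [← h, integral_map (by fun_prop) (by fun_prop), gaussianFourthMoment, ← integral_const_mul]
  congr 1
  ext x
  rw [mul_pow, show (4 : ℕ) = 2 * 2 from rfl, pow_mul, Real.sq_sqrt (NNReal.coe_nonneg v)]

theorem integral_sq_gaussianReal (v : NNReal) : ∫ x, x ^ 2 ∂gaussianReal 0 v = v := by
  have h := variance_fun_id_gaussianReal (μ := 0) (v := v)
  rw [variance_eq_integral (by fun_prop)] at h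
  simpa using h

theorem memLp_sq_gaussianReal (v : NNReal) : MemLp (fun x : ℝ => x ^ 2) 2 (gaussianReal 0 v) := by
  refine (memLp_two_iff_integrable_sq (by fun_prop)).mpr ?_
  have h := (memLp_id_gaussianReal (μ := 0) (v := v) 4).integrable_norm_pow (by norm_num)
  refine h.congr (ae_of_all _ fun x => ?_)
  simp only [id, Real.norm_eq_abs]
  rw [← pow_mul]
  exact (even_two_mul 2).pow_abs x

/-- Chebyshev's inequality for a sum of squares of at most `m` independent centred Gaussian
variables. -/
theorem measureReal_sum_sq_ge_le {ι : Type*} [Fintype ι] {X : ι → Ω → ℝ} {var : ι → NNReal}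
    {D m s : ℝ} (hmeas : ∀ i, Measurable (X i))
    (hlaw : ∀ i, P.map (X i) = gaussianReal 0 (var i)) (hindep : iIndepFun X P) (hD : 0 < D)
    (hvar : ∀ i, (var i : ℝ) ≤ D) (hm0 : 0 < m) (hm : (Fintype.card ι : ℝ) ≤ m) (hs : 1 ≤ s) :
    P.real {ω | 2 * D * m * s ≤ ∑ i, X i ω ^ 2} ≤ gaussianFourthMoment / (m * s ^ 2) := by
  have hLp : ∀ i, MemLp (fun ω => X i ω ^ 2) 2 P := by
    intro i
    have h := memLp_sq_gaussianReal (var i)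
    rw [← hlaw i] at h
    exact h.comp_of_map (hmeas i).aemeasurable
  have hmean : ∀ i, ∫ ω, X i ω ^ 2 ∂P ≤ D := by
    intro i
    refine le_trans (le_of_eq ?_) (hvar i)
    rw [← integral_sq_gaussianReal, ← hlaw i,
      integral_map (hmeas i).aemeasurable (by fun_prop)]
  have hvariance : ∀ i, variance (fun ω => X i ω ^ 2) P ≤ D ^ 2 * gaussianFourthMoment := by
    intro i
    refine (variance_le_expectation_sq (hLp i).1).trans ?_
    have h : ∫ ω, ((fun ω => X i ω ^ 2) ^ 2) ω ∂P = (var i : ℝ) ^ 2 * gaussianFourthMoment := by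
      rw [← integral_pow_four_gaussianReal, ← hlaw i,
        integral_map (hmeas i).aemeasurable (by fun_prop)]
      congr 1
      ext ω
      simp only [Pi.pow_apply]
      ring
    rw [h]
    have := gaussianFourthMoment_nonneg
    have := NNReal.coe_nonneg (var i)
    gcongr
    exact hvar i
  set S : Ω → ℝ := ∑ i, fun ω => X i ω ^ 2 with hS
  have hSLp : MemLp S 2 P := by
    simpa [hS] using memLp_finsetSum' Finset.univ fun i _ => hLp i
  have hSmean : ∫ ω, S ω ∂P ≤ D * m := by
    simp only [hS, Finset.sum_apply]
    rw [integral_finsetSum _ fun i _ => (hLp i).integrable (by norm_num)]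
    refine (Finset.sum_le_sum fun i _ => hmean i).trans ?_
    rw [Finset.sum_const, Finset.card_univ, nsmul_eq_mul, mul_comm]
    gcongr
  have hSvar : variance S P ≤ m * (D ^ 2 * gaussianFourthMoment) := by
    rw [hS, IndepFun.variance_sum (fun i _ => hLp i)]
    · refine (Finset.sum_le_sum fun i _ => hvariance i).trans ?_
      rw [Finset.sum_const, Finset.card_univ, nsmul_eq_mul]
      have := gaussianFourthMoment_nonneg
      gcongr
    · intro i _ j _ hij
      exact (hindep.indepFun hij).comp (φ := fun x => x ^ 2) (ψ := fun x => x ^ 2)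
        (by fun_prop) (by fun_prop)
  have hc : 0 < D * m * s := by positivity
  have hcheb := meas_ge_le_variance_div_sq hSLp hc
  have hsub : {ω | 2 * D * m * s ≤ ∑ i, X i ω ^ 2} ⊆ {ω | D * m * s ≤ |S ω - ∫ ω, S ω ∂P|} := by
    intro ω hω
    simp only [Set.mem_ofPred_eq] at hω ⊢
    refine le_trans ?_ (le_abs_self _)
    have h1 : S ω = ∑ i, X i ω ^ 2 := by simp [hS]
    have h2 : D * m * 1 ≤ D * m * s := by gcongr
    rw [h1]
    linarith
  have h := ENNReal.toReal_mono ENNReal.ofReal_ne_top ((measure_mono hsub).trans hcheb)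
  rw [ENNReal.toReal_ofReal (by have := variance_nonneg S P; positivity)] at h
  refine h.trans ?_
  calc variance S P / (D * m * s) ^ 2
      ≤ m * (D ^ 2 * gaussianFourthMoment) / (D * m * s) ^ 2 := by gcongr
    _ = _ := by field_simp

end Gaussian

/-! ### The reduced graph for a fixed noise -/

section Deterministic

variable {V : Type u} [Fintype V]

/-- Markov's inequality for the counting measure. -/
theorem ncard_lt_neg_mul_sq_le (f : V → ℝ) {R K : ℝ} (hR : 0 ≤ R) (hK : K ≤ -R) :
    ({x | f x < K}.ncard : ℝ) * R ^ 2 ≤ ∑ x, f x ^ 2 := by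
  classical
  rw [Set.ncard_eq_toFinset_card', ← nsmul_eq_mul, ← Finset.sum_const]
  refine (Finset.sum_le_sum fun x hx => ?_).trans
    (Finset.sum_le_sum_of_subset_of_nonneg (Finset.subset_univ _) fun x _ _ => sq_nonneg (f x))
  have hx' : f x < K := by simpa using hx
  nlinarith

variable [DecidableEq V] {G : SimpleGraph V} [DecidableRel G.Adj] {d : ℕ} {Ω : Type v}

/-- Deterministic control of the pruned field. Because of the exponential decay of `xi`, the noise
may grow exponentially in `k` at a slower rate without spoiling convergence of the series in
`ℓ²`. -/
theorem sum_sq_psiOne_le (hd : 2 ≤ d) (hconn : G.Connected) (hreg : G.IsRegularOfDegree d)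
    {β κ B t : ℝ} (hβ : β ≤ spectralGap G) (hκ0 : 0 < κ) (hκ1 : κ < 1)
    (hκ : 1 - β / 2 ≤ κ ^ 8) (hB : 0 ≤ B) {W : NoiseIndex G → Ω → ℝ} {ω : Ω}
    (hfirst : ∑ z, W (NoiseIndex.first z) ω ^ 2 ≤ B)
    (hlater : ∀ k, ∑ z, W (NoiseIndex.later k z) ω ^ 2 ≤ B / κ ^ (2 * k)) :
    ∑ x, psiOne G t W x ω ^ 2 ≤ (1 + (1 - κ)⁻¹) ^ 2 * B := by
  set ξ₀ : EuclideanSpace ℝ V :=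
    WithLp.toLp 2 (xi G 0 fun z => W (NoiseIndex.first z) ω) with hξ₀
  set ξ : ℕ → EuclideanSpace ℝ V := fun k =>
    WithLp.toLp 2 (xi G (k + 1) fun z => W (NoiseIndex.later k z) ω) with hξ
  have h0 : ‖ξ₀‖ ≤ Real.sqrt B := by
    refine Real.le_sqrt_of_sq_le ?_
    rw [EuclideanSpace.real_norm_sq_eq]
    exact (sum_sq_xi_zero_le (by omega) hreg _).trans hfirst
  have hk : ∀ k, ‖ξ k‖ ≤ κ ^ k * Real.sqrt B := by
    intro k
    rw [← Real.sqrt_sq (pow_pos hκ0 k).le, ← Real.sqrt_mul (sq_nonneg _)]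
    refine Real.le_sqrt_of_sq_le ?_
    rw [EuclideanSpace.real_norm_sq_eq]
    refine (sum_sq_xi_le hd hconn hreg hβ (pow_pos hκ0 8).le hκ _ (k + 1)).trans ?_
    -- Half of the decay `κ ^ (4 * k)` absorbs the growth of the noise, the rest makes the norms
    -- summable.
    have hpow : (κ ^ 8) ^ ((k + 1) / 2) ≤ κ ^ (4 * k) := by
      rw [← pow_mul]
      exact pow_le_pow_of_le_one hκ0.le hκ1.le (by omega)
    calc (κ ^ 8) ^ ((k + 1) / 2) * ∑ z, W (NoiseIndex.later k z) ω ^ 2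
        ≤ κ ^ (4 * k) * (B / κ ^ (2 * k)) := by
          gcongr
          exact hlater k
      _ = (κ ^ k) ^ 2 * B := by
          rw [show 4 * k = 2 * k + 2 * k by ring, pow_add, ← pow_mul, mul_comm k 2]
          field_simp
  have hgeom : HasSum (fun k => κ ^ k * Real.sqrt B) ((1 - κ)⁻¹ * Real.sqrt B) :=
    (hasSum_geometric_of_lt_one hκ0.le hκ1).mul_right _
  have hsummable : Summable ξ := Summable.of_norm_bounded hgeom.summable hk
  have hpsi : (WithLp.toLp 2 fun x => psiOne G t W x ω)
      = Real.sqrt (1 - t ^ 2) • ξ₀ + ∑' k, ξ k := by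
    ext x
    have h := (EuclideanSpace.proj (𝕜 := ℝ) x : EuclideanSpace ℝ V →L[ℝ] ℝ).map_tsum hsummable
    change (∑' k, ξ k) x = ∑' k, ξ k x at h
    change psiOne G t W x ω = Real.sqrt (1 - t ^ 2) * ξ₀ x + (∑' k, ξ k) x
    rw [h]
    rfl
  have hsqrt : ‖Real.sqrt (1 - t ^ 2)‖ ≤ 1 := by
    rw [Real.norm_of_nonneg (Real.sqrt_nonneg _), Real.sqrt_le_one]
    linarith [sq_nonneg t]
  have hnorm : ‖(WithLp.toLp 2 fun x => psiOne G t W x ω : EuclideanSpace ℝ V)‖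
      ≤ (1 + (1 - κ)⁻¹) * Real.sqrt B := by
    rw [hpsi]
    refine (norm_add_le _ _).trans ?_
    rw [norm_smul, add_mul, one_mul]
    refine add_le_add ?_ (tsum_of_norm_bounded hgeom hk)
    calc _ ≤ 1 * Real.sqrt B := by gcongr
      _ = _ := one_mul _
  calc ∑ x, psiOne G t W x ω ^ 2
      = ‖(WithLp.toLp 2 fun x => psiOne G t W x ω : EuclideanSpace ℝ V)‖ ^ 2 := by
        rw [EuclideanSpace.real_norm_sq_eq]
    _ ≤ ((1 + (1 - κ)⁻¹) * Real.sqrt B) ^ 2 := by gcongr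
    _ = _ := by rw [mul_pow, Real.sq_sqrt hB]

/-- If few vertices are removed, then macroscopic sets keep half of their boundary. -/
theorem mem_expansionEvent {t K L δ b : ℝ} (hδ : 0 < δ) (hb : 0 ≤ b) [Nonempty V]
    {W : NoiseIndex G → Ω → ℝ} {ω : Ω}
    (hiso : ∀ A : Set V, A.Nonempty → (A.ncard : ℝ) ≤ (Fintype.card V : ℝ) / 2 →
      b ≤ ((vertexBoundary G A).ncard : ℝ) / A.ncard)
    (hfew : ((hatV G t K L W ω)ᶜ.ncard : ℝ) ≤ b / 2 * (δ * Fintype.card V)) :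
    ω ∈ expansionEvent G t K L δ (b / 2) W := by
  intro A hA1 hA2
  have hN : (0 : ℝ) < Fintype.card V := by exact_mod_cast Fintype.card_pos
  have hA0 : (0 : ℝ) < A.ncard := lt_of_lt_of_le (by positivity) hA1
  set A' : Set V := Subtype.val '' A with hA'
  have hcard : A'.ncard = A.ncard := Set.ncard_image_of_injective _ Subtype.val_injective
  have hne : A'.Nonempty := by
    refine (Set.ncard_pos).mp ?_
    rw [hcard]
    exact_mod_cast hA0
  have h := hiso A' hne (by rwa [hcard])
  rw [hcard, le_div_iff₀ hA0] at h
  have hsub : vertexBoundary G A' ⊆ Subtype.val '' vertexBoundary (hatG G t K L W ω) A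
      ∪ (hatV G t K L W ω)ᶜ := by
    rintro y ⟨hy, x, ⟨x', hx', rfl⟩, hxy⟩
    by_cases hyV : y ∈ hatV G t K L W ω
    · refine Or.inl ⟨⟨y, hyV⟩, ⟨fun h => hy ⟨_, h, rfl⟩, x', hx', ?_⟩, rfl⟩
      exact hxy
    · exact Or.inr hyV
  have hle : ((vertexBoundary G A').ncard : ℝ)
      ≤ (vertexBoundary (hatG G t K L W ω) A).ncard + (hatV G t K L W ω)ᶜ.ncard := by
    have := (Set.ncard_le_ncard hsub).trans (Set.ncard_union_le _ _)
    rw [Set.ncard_image_of_injective _ Subtype.val_injective] at this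
    exact_mod_cast this
  rw [le_div_iff₀ hA0]
  have : b / 2 * (δ * Fintype.card V) ≤ b / 2 * A.ncard := by gcongr
  linarith

end Deterministic

/-! ### The probability estimate -/

section Probability

theorem measureReal_iUnion_le_of_hasSum {Ω : Type v} [MeasurableSpace Ω] {P : Measure Ω}
    [IsProbabilityMeasure P] {S : ℕ → Set Ω} {g : ℕ → ℝ} {a : ℝ} (hg : HasSum g a)
    (h : ∀ k, P.real (S k) ≤ g k) : P.real (⋃ k, S k) ≤ a := by
  have hg0 : ∀ k, 0 ≤ g k := fun k => measureReal_nonneg.trans (h k)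
  rw [← hg.tsum_eq]
  refine ENNReal.toReal_le_of_le_ofReal (tsum_nonneg hg0) ?_
  rw [ENNReal.ofReal_tsum_of_nonneg hg0 hg.summable]
  refine (measure_iUnion_le _).trans (ENNReal.tsum_le_tsum fun k => ?_)
  rw [← ofReal_measureReal]
  exact ENNReal.ofReal_le_ofReal (h k)

variable {V : Type u} [Fintype V] [DecidableEq V] {G : SimpleGraph V} [DecidableRel G.Adj] {d : ℕ}

theorem siteVariance_le (z : SubdivVertex G) : (siteVariance G d z : ℝ) ≤ d := by
  have h : siteVariance G d z ≤ (d : NNReal) := by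
    rw [siteVariance]
    rcases Nat.eq_zero_or_pos ((subdiv G).degree z) with h0 | h0
    · simp [h0]
    · have h1 : (1 : NNReal) ≤ ((subdiv G).degree z : NNReal) := by exact_mod_cast h0
      exact (div_le_self zero_le h1).trans (div_le_self zero_le (by norm_num))
  exact_mod_cast h

theorem noiseVariance_le (i : NoiseIndex G) : (noiseVariance G d i : ℝ) ≤ d := by
  cases i <;> exact siteVariance_le _

/-- With probability at least `1 - 1 / N`, the noise at every level has an `ℓ²` norm of order
`√N`, with a factor that may grow exponentially in the level. -/
theorem measureReal_noise_large_le (hd : 2 ≤ d) (hreg : G.IsRegularOfDegree d) [Nonempty V]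
    {κ s : ℝ} (hκ0 : 0 < κ) (hκ1 : κ < 1) (hs : 1 ≤ s)
    (hs' : gaussianFourthMoment * (2 + (1 - κ ^ 4)⁻¹) ≤ s)
    {Ω : Type v} [MeasurableSpace Ω] {P : Measure Ω} [IsProbabilityMeasure P]
    {W : NoiseIndex G → Ω → ℝ} (hW : IsNoise G d P W) :
    P.real ({ω | 2 * d * (d * Fintype.card V) * s ≤ ∑ x, W (NoiseIndex.bar x) ω ^ 2} ∪
      {ω | 2 * d * (d * Fintype.card V) * s ≤ ∑ z, W (NoiseIndex.first z) ω ^ 2} ∪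
      ⋃ k, {ω | 2 * d * (d * Fintype.card V) * (s / κ ^ (2 * k))
        ≤ ∑ z, W (NoiseIndex.later k z) ω ^ 2}) ≤ (Fintype.card V : ℝ)⁻¹ := by
  have hd' : (2 : ℝ) ≤ d := by exact_mod_cast hd
  have hd0 : (0 : ℝ) < d := by linarith
  have hN : (0 : ℝ) < Fintype.card V := by exact_mod_cast Fintype.card_pos
  have hm4 := gaussianFourthMoment_nonneg
  have hm0 : 0 < (d : ℝ) * Fintype.card V := by positivity
  have hcardV : (Fintype.card V : ℝ) ≤ d * Fintype.card V := by nlinarith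
  have hcard : (Fintype.card (SubdivVertex G) : ℝ) ≤ d * Fintype.card V := by
    rw [Fintype.card_sum, Nat.cast_add]
    have := two_mul_card_edgeSet hreg
    nlinarith
  have hκ4 : κ ^ 4 < 1 := pow_lt_one₀ hκ0.le hκ1 (by norm_num)
  have hbound {ι : Type u} [Fintype ι] (j : ι → NoiseIndex G) (hj : j.Injective)
      (hι : (Fintype.card ι : ℝ) ≤ d * Fintype.card V) {r : ℝ} (hr : 1 ≤ r) :
      P.real {ω | 2 * d * (d * Fintype.card V) * r ≤ ∑ i, W (j i) ω ^ 2}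
        ≤ gaussianFourthMoment / (d * Fintype.card V * r ^ 2) :=
    measureReal_sum_sq_ge_le (fun i => hW.measurable (j i)) (fun i => hW.law (j i))
      (hW.indep.precomp hj) hd0 (fun i => noiseVariance_le (j i)) hm0 hι hr
  have hbar := hbound (fun x => NoiseIndex.bar x) (fun x y h => by injection h) hcardV hs
  have hfirst := hbound (fun z => NoiseIndex.first z) (fun x y h => by injection h) hcard hs
  have hlater (k : ℕ) := hbound (fun z => NoiseIndex.later k z) (fun x y h => by injection h)
    hcard (r := s / κ ^ (2 * k)) (by
      rw [le_div_iff₀ (by positivity), one_mul]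
      exact (pow_le_one₀ hκ0.le hκ1.le).trans hs)
  set a := gaussianFourthMoment / (d * Fintype.card V * s ^ 2) with ha
  have hgeom : HasSum (fun k => a * (κ ^ 4) ^ k) (a * (1 - κ ^ 4)⁻¹) :=
    (hasSum_geometric_of_lt_one (by positivity) hκ4).mul_left _
  have hunion := measureReal_iUnion_le_of_hasSum (P := P) hgeom fun k => (hlater k).trans (by
    refine le_of_eq ?_
    rw [ha, div_pow, ← pow_mul, ← pow_mul]
    rw [show 2 * k * 2 = 4 * k by ring]
    field_simp)
  refine (measureReal_union_le _ _).trans ((add_le_add (measureReal_union_le _ _) le_rfl).trans ?_)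
  refine (add_le_add (add_le_add hbar hfirst) hunion).trans ?_
  have h1 : a + a + a * (1 - κ ^ 4)⁻¹
      = gaussianFourthMoment * (2 + (1 - κ ^ 4)⁻¹) / (d * Fintype.card V * s ^ 2) := by
    rw [ha]; ring
  rw [h1, div_le_iff₀ (by positivity)]
  have h2 : (Fintype.card V : ℝ)⁻¹ * (d * Fintype.card V * s ^ 2) = d * s ^ 2 := by field_simp
  rw [h2]
  nlinarith

/-- The expansion event for one graph. -/
theorem one_sub_inv_card_le_measureReal_expansionEvent (hd : 2 ≤ d) (hconn : G.Connected)
    (hreg : G.IsRegularOfDegree d) {β κ s : ℝ} (hβ : β ≤ spectralGap G) (hκ0 : 0 < κ)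
    (hκ1 : κ < 1) (hκ : 1 - β / 2 ≤ κ ^ 8) (hs : 1 ≤ s)
    (hs' : gaussianFourthMoment * (2 + (1 - κ ^ 4)⁻¹) ≤ s) {b δ R K L t : ℝ} (hδ : 0 < δ)
    (hb : 0 < b) (hR0 : 0 < R)
    (hR : 4 * d ^ 2 * s * (1 + (1 - κ)⁻¹) ^ 2 ≤ b / 2 * δ * R ^ 2) (hK : K ≤ -R) (hL : L ≤ -R)
    (hiso : ∀ A : Set V, A.Nonempty → (A.ncard : ℝ) ≤ (Fintype.card V : ℝ) / 2 →
      b ≤ ((vertexBoundary G A).ncard : ℝ) / A.ncard)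
    {Ω : Type v} [MeasurableSpace Ω] {P : Measure Ω} [IsProbabilityMeasure P]
    {W : NoiseIndex G → Ω → ℝ} (hW : IsNoise G d P W) :
    1 - (Fintype.card V : ℝ)⁻¹ ≤ P.real (expansionEvent G t K L δ (b / 2) W) := by
  have hne := hconn.nonempty
  have hN : (0 : ℝ) < Fintype.card V := by exact_mod_cast Fintype.card_pos
  have hlarge := measureReal_noise_large_le hd hreg hκ0 hκ1 hs hs' hW
  set N : ℝ := (Fintype.card V : ℝ) with hNdef
  set Large := {ω | 2 * d * (d * N) * s ≤ ∑ x, W (NoiseIndex.bar x) ω ^ 2} ∪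
      {ω | 2 * d * (d * N) * s ≤ ∑ z, W (NoiseIndex.first z) ω ^ 2} ∪
      ⋃ k, {ω | 2 * d * (d * N) * (s / κ ^ (2 * k))
        ≤ ∑ z, W (NoiseIndex.later k z) ω ^ 2} with hLarge
  have hcover : Set.univ ⊆ expansionEvent G t K L δ (b / 2) W ∪ Large := by
    intro ω _
    by_cases hω : ω ∈ Large
    · exact Or.inr hω
    refine Or.inl (mem_expansionEvent hδ hb.le hiso ?_)
    simp only [hLarge, Set.mem_union, Set.mem_iUnion, Set.mem_ofPred_eq, not_or, not_exists,
      not_le] at hω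
    obtain ⟨⟨hbar, hfirst⟩, hlater⟩ := hω
    set B := 2 * d * (d * N) * s with hB
    have hB0 : 0 ≤ B := by positivity
    have hpsi := sum_sq_psiOne_le (t := t) hd hconn hreg hβ hκ0 hκ1 hκ hB0 hfirst.le fun k =>
      (hlater k).le.trans (le_of_eq (by rw [hB]; ring))
    have h1 := ncard_lt_neg_mul_sq_le (fun x => psiOne G t W x ω) hR0.le hK
    have h2 := ncard_lt_neg_mul_sq_le (fun x => W (NoiseIndex.bar x) ω) hR0.le hL
    have hC : 1 ≤ (1 + (1 - κ)⁻¹) ^ 2 := by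
      have : 0 ≤ (1 - κ)⁻¹ := inv_nonneg.mpr (by linarith)
      nlinarith
    have hsub : (hatV G t K L W ω)ᶜ
        ⊆ {x | psiOne G t W x ω < K} ∪ {x | W (NoiseIndex.bar x) ω < L} := by
      intro x hx
      by_contra hcon
      simp only [Set.mem_union, Set.mem_ofPred_eq, not_or, not_lt] at hcon
      exact hx ⟨hcon.2, hcon.1⟩
    have h3 : ((hatV G t K L W ω)ᶜ.ncard : ℝ) ≤ {x | psiOne G t W x ω < K}.ncard
        + {x | W (NoiseIndex.bar x) ω < L}.ncard := by
      exact_mod_cast (Set.ncard_le_ncard hsub).trans (Set.ncard_union_le _ _)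
    refine le_of_mul_le_mul_right ?_ (pow_pos hR0 2)
    calc ((hatV G t K L W ω)ᶜ.ncard : ℝ) * R ^ 2
        ≤ ({x | psiOne G t W x ω < K}.ncard + {x | W (NoiseIndex.bar x) ω < L}.ncard) * R ^ 2 := by
          gcongr
      _ ≤ (1 + (1 - κ)⁻¹) ^ 2 * B + (1 + (1 - κ)⁻¹) ^ 2 * B := by
          rw [add_mul]
          refine add_le_add (h1.trans hpsi) (h2.trans (hbar.le.trans ?_))
          exact le_mul_of_one_le_left hB0 hC
      _ = 4 * d ^ 2 * s * (1 + (1 - κ)⁻¹) ^ 2 * N := by rw [hB]; ring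
      _ ≤ b / 2 * δ * R ^ 2 * N := by gcongr
      _ = b / 2 * (δ * N) * R ^ 2 := by ring
  have h := (measureReal_mono (μ := P) hcover).trans (measureReal_union_le _ _)
  rw [probReal_univ] at h
  linarith

end Probability

end ZeroAvgGFF

theorem lemma8p1 (d : ℕ) (hd : 3 ≤ d) (α : ℝ) (hα0 : 0 < α) (hα1 : α < 1) (β : ℝ) (hβ : 0 < β) :
    (∃ β' : ℝ, 0 < β' ∧
      ∀ (V : ℕ → Type u) [∀ n, Fintype (V n)] [∀ n, DecidableEq (V n)]
        (G : ∀ n, SimpleGraph (V n)) [∀ n, DecidableRel (G n).Adj],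
        ZeroAvgGFF.GraphAssumptions d α β V G → ZeroAvgGFF.UniformIsoperimetry β' V G) ∧
    ∃ ε : ℝ, 0 < ε ∧ ∀ β' : ℝ, 0 < β' → ∀ δ : ℝ, 0 < δ → ∃ K₀ L₀ : ℝ,
      ∀ (V : ℕ → Type u) [∀ n, Fintype (V n)] [∀ n, DecidableEq (V n)]
        (G : ∀ n, SimpleGraph (V n)) [∀ n, DecidableRel (G n).Adj],
        ZeroAvgGFF.GraphAssumptions d α β V G → ZeroAvgGFF.UniformIsoperimetry β' V G →
        ∀ K : ℝ, K < K₀ → ∀ L : ℝ, L < L₀ →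
        ∀ t : ℕ → ℝ, (∀ n, 0 < t n ∧ t n < 1) →
        ∀ (n : ℕ) (Ω : Type v) [MeasurableSpace Ω] (P : Measure Ω) [IsProbabilityMeasure P]
          (W : ZeroAvgGFF.NoiseIndex (G n) → Ω → ℝ), ZeroAvgGFF.IsNoise (G n) d P W →
          1 - (Fintype.card (V n) : ℝ) ^ (-ε) ≤
            P.real (ZeroAvgGFF.expansionEvent (G n) (t n) K L δ (β' / 2) W) := by
  refine ⟨⟨β / 2, by positivity, ?_⟩, 1, one_pos, ?_⟩
  · intro V _ _ G _ hG n A hA hAN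
    have hA0 : (0 : ℝ) < A.ncard := by exact_mod_cast (Set.ncard_pos).mpr hA
    rw [le_div_iff₀ hA0]
    exact ZeroAvgGFF.mul_card_le_card_vertexBoundary (by omega) (hG.connected n) (hG.regular n)
      hβ.le (hG.gap n) A hAN
  · intro b hb δ hδ
    -- A bound for the contraction factor of the lazy step; the maximum keeps it positive.
    set ρ := max (1 - β / 2) (1 / 2) with hρ
    have hρ0 : 0 < ρ := lt_of_lt_of_le (by norm_num) (le_max_right _ _)
    have hρ1 : ρ < 1 := max_lt (by linarith) (by norm_num)
    obtain ⟨κ, hκ0, hκ1, hκρ⟩ : ∃ κ : ℝ, 0 < κ ∧ κ < 1 ∧ κ ^ 8 = ρ := by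
      refine ⟨ρ ^ (1 / 8 : ℝ), by positivity, Real.rpow_lt_one hρ0.le hρ1 (by norm_num), ?_⟩
      rw [← Real.rpow_natCast, ← Real.rpow_mul hρ0.le]
      norm_num
    have hκ : 1 - β / 2 ≤ κ ^ 8 := hκρ ▸ le_max_left _ _
    -- `s` makes the exceptional probability at most `1 / N`; given `s`, the threshold `-R` makes the
    -- number of removed vertices at most `b δ N / 2` on the complementary event.
    set s := max 1 (ZeroAvgGFF.gaussianFourthMoment * (2 + (1 - κ ^ 4)⁻¹))
    set R := 1 + 4 * d ^ 2 * s * (1 + (1 - κ)⁻¹) ^ 2 / (b / 2 * δ) with hR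
    have hs0 : 0 < s := lt_of_lt_of_le one_pos (le_max_left _ _)
    have hq : 0 ≤ 4 * d ^ 2 * s * (1 + (1 - κ)⁻¹) ^ 2 / (b / 2 * δ) := by positivity
    have hR1 : 1 ≤ R := by linarith
    have hR2 : 4 * d ^ 2 * s * (1 + (1 - κ)⁻¹) ^ 2 ≤ b / 2 * δ * R ^ 2 := by
      rw [mul_comm _ (R ^ 2), ← div_le_iff₀ (by positivity)]
      nlinarith
    refine ⟨-R, -R, ?_⟩
    intro V _ _ G _ hG hiso K hK L hL t _ n Ω _ P _ W hW
    rw [Real.rpow_neg_one]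
    exact ZeroAvgGFF.one_sub_inv_card_le_measureReal_expansionEvent (by omega) (hG.connected n)
      (hG.regular n) (hG.gap n) hκ0 hκ1 hκ (le_max_left _ _) (le_max_right _ _) hδ hb
      (by linarith) hR2 hK.le hL.le (hiso n) hW
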